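/- Let $d\ge 2$ and let $F\subset\mathbb R^{d-1}$ be a compact convex set with $\mathrm{Vol}_{d-1}(F)=1$. A compact convex set $K\subset\mathbb R^d$ has floor $F$ if $K\subset\{x_d\ge 0\}$ and $K\cap\{x_d=0\}=F\times\{0\}$. Let $\mathrm{SubPrism}(F)$ be the set of all compact convex $K\subset\mathbb R^d$ with floor $F$ and $\mathrm{Vol}_d(K)=1$ such that $K\subset F\times[0,H]$ for some $H\ge 0$. For $K$ of volume $1$ with floor $F$, let $Q_K(2)$ be the probability that two independent uniform random points $U_1,U_2$ of $K$ both lie on the boundary of the convex hull of $(F\times\{0\})\cup\{U_1,U_2\}$. Call unit prism the set $F\times[0,1]$, and unit mountain any set of the form $\mathrm{CH}(\{z\}\cup(F\times\{0\}))$ with $z\in\mathbb R^d$, $z_d\ge 0$, and with $d$-volume $1$ (the apex $z$ need not lie above $F$). Then the unit prism belongs to $\mathrm{SubPrism}(F)$, so does some unit mountain, and for every $K\in\mathrm{SubPrism}(F)$ and every unit mountain $M$, $$Q_M(2)\;\le\; Q_K(2)\;\le\; Q_{F\times[0,1]}(2).$$ Moreover, for every unit mountain $M$, $$Q_M(2)=1-\frac{2}{d+1},\qquad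 Q_{F\times[0,1]}(2)=1-\frac1d ,$$ and neither value depends on $F$. -/

import Mathlib

open MeasureTheory

namespace FlatFloor

/-- `ℝᵈ`, written as `ℝᵈ⁻¹ × ℝ`: a point is a pair (first `d - 1` coordinates, height). Only the
linear structure, the topology and the Lebesgue measure `volume` (the product of the Lebesgue
measures of the two factors) of this space are used. -/
abbrev Space (d : ℕ) : Type := EuclideanSpace ℝ (Fin (d - 1)) × ℝ

/-- `F ⊆ ℝᵈ⁻¹` seen in `ℝᵈ` at height zero, i.e. `F × {0}`. -/
def base {d : ℕ} (F : Set (EuclideanSpace ℝ (Fin (d - 1)))) : Set (Space d) :=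
  F ×ˢ {(0 : ℝ)}

/-- `K` is a compact convex set of `ℝᵈ` with floor `F`: it lies in the half-space of nonnegative
heights, and it meets the hyperplane of height zero exactly in `F × {0}`. -/
structure HasFloor {d : ℕ} (K : Set (Space d))
    (F : Set (EuclideanSpace ℝ (Fin (d - 1)))) : Prop where
  isCompact : IsCompact K
  convex : Convex ℝ K
  height_nonneg : ∀ p ∈ K, 0 ≤ p.2
  inter_eq : K ∩ {p | p.2 = 0} = base F

/-- The sub-prisms with floor `F` and volume `1`. -/
def SubPrism {d : ℕ} (F : Set (EuclideanSpace ℝ (Fin (d - 1)))) : Set (Set (Space d)) :=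
  {K | HasFloor K F ∧ (∃ H : ℝ, 0 ≤ H ∧ K ⊆ F ×ˢ Set.Icc 0 H) ∧ volume K = 1}

/-- The mountain with floor `F` and apex `z`: the convex hull of `z` and the floor. -/
def mountain {d : ℕ} (F : Set (EuclideanSpace ℝ (Fin (d - 1)))) (z : Space d) :
    Set (Space d) :=
  convexHull ℝ ({z} ∪ base F)

/-- `M` is a mountain over `F` of volume `1`. The apex need not lie above `F`. -/
def IsUnitMountain {d : ℕ} (F : Set (EuclideanSpace ℝ (Fin (d - 1)))) (M : Set (Space d)) :
    Prop :=
  (∃ z : Space d, 0 ≤ z.2 ∧ M = mountain F z) ∧ volume M = 1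

/-- The unit prism `F × [0, 1]`. -/
def unitPrism {d : ℕ} (F : Set (EuclideanSpace ℝ (Fin (d - 1)))) : Set (Space d) :=
  F ×ˢ Set.Icc (0 : ℝ) 1

/-- The uniform probability distribution on `K` (normalised Lebesgue measure). -/
noncomputable def uniform {d : ℕ} (K : Set (Space d)) : Measure (Space d) :=
  ProbabilityTheory.cond volume K

/-- `Q_K(2)` for a set `K` with floor `F`: the probability that two independent uniform points of
`K` both lie on the boundary of the convex hull of the floor and these two points. -/
noncomputable def Q {d : ℕ} (F : Set (EuclideanSpace ℝ (Fin (d - 1)))) (K : Set (Space d)) : ℝ :=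
  ((uniform K).prod (uniform K)).real
    {u | u.1 ∈ frontier (convexHull ℝ (base F ∪ {u.1, u.2})) ∧
      u.2 ∈ frontier (convexHull ℝ (base F ∪ {u.1, u.2}))}

end FlatFloor

/-!
Two points of `K` in general position fail to lie both on the boundary of the hull of the floor and
the points exactly when one of them is in the mountain whose apex is the other one. The two cases
exclude each other, because the apex is the higher point. The mountain with apex `U` lies in `K` and
has volume `height(U) / d`, so that `Q F K = 1 - (2 / d) * E[height of a uniform point of K]`
(`Q_eq_one_sub_mean_height`), and the theorem becomes a comparison of mean heights.

The mean height depends only on the areas `A(t)` of the horizontal sections, which have integral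
`1`. If the difference of two such area functions changes sign once, then their first moments are
ordered (`integral_mul_le_of_single_crossing`). For a sub-prism `A ≤ 1`, so the comparison with the
prism is immediate. For the comparison with the mountain, whose area is `(1 - t / d) ^ (d - 1)`,
Brunn's theorem says that `A ^ (1 / (d - 1))` lies above its chords from `0`, where it is `1`
(`pow_le_area`). A function that is affine with the same value at `0` is therefore crossed at most
once, from above to below.

Brunn's theorem is the Brunn–Minkowski inequality `brunn_minkowski`, which is obtained from the
Prékopa–Leindler inequality `prekopa_leindler` by scaling. The latter is proved by induction on the
dimension, from the one-dimensional case that follows from the Brunn–Minkowski inequality on the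
line applied to superlevel sets.
-/

namespace FlatFloor

open scoped ENNReal

/-! ### The Prékopa–Leindler inequality -/

/-- The one-dimensional Brunn–Minkowski inequality, for a weighted sum. -/
theorem volume_add_volume_le_of_combination_mem {p q : ℝ} (hp : 0 < p) (hq : 0 < q)
    {A B C : Set ℝ} (hA : MeasurableSet A) (hB : MeasurableSet B)
    (hAne : A.Nonempty) (hBne : B.Nonempty)
    (hC : ∀ x ∈ A, ∀ y ∈ B, p * x + q * y ∈ C) :
    ENNReal.ofReal p * volume A + ENNReal.ofReal q * volume B ≤ volume C := by
  -- On compact subsets `K ⊆ A` and `L ⊆ B`, the sets `p K + q min L` and `p max K + q L` lie in `C`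
  -- and share only the point `p max K + q min L`.
  have key : ∀ K ⊆ A, ∀ L ⊆ B, IsCompact K → IsCompact L → K.Nonempty → L.Nonempty →
      ENNReal.ofReal p * volume K + ENNReal.ofReal q * volume L ≤ volume C := by
    intro K hKA L hLB hK hL hKne hLne
    obtain ⟨a, haK, ha⟩ := hK.exists_isGreatest hKne
    obtain ⟨b, hbL, hb⟩ := hL.exists_isLeast hLne
    have hvol : ∀ (r : ℝ), 0 < r → ∀ (c : ℝ) (S : Set ℝ),
        volume ((fun x => r * x + c) '' S) = ENNReal.ofReal r * volume S := by
      intro r hr c S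
      have : (fun x => r * x + c) '' S = (fun x => x + c) '' ((fun x => r * x) '' S) := by
        rw [Set.image_image]
      rw [this, Set.image_add_right, measure_preimage_add_right]
      have h := Measure.addHaar_smul volume r S
      rwa [Module.finrank_self, pow_one, abs_of_pos hr, ← Set.image_smul] at h
    set X := (fun x => p * x + q * b) '' K
    set Y := (fun x => q * x + p * a) '' L
    have hY : MeasurableSet Y := (hL.image (by fun_prop)).measurableSet
    have hXY : AEDisjoint volume X Y := by
      refine measure_mono_null (t := {p * a + q * b}) ?_ (by simp)
      rintro _ ⟨⟨x, hx, rfl⟩, ⟨y, hy, hxy⟩⟩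
      have h1 := mul_le_mul_of_nonneg_left (ha hx) hp.le
      have h2 := mul_le_mul_of_nonneg_left (hb hy) hq.le
      simp only [Set.mem_singleton_iff] at hxy ⊢
      linarith
    rw [← hvol p hp (q * b) K, ← hvol q hq (p * a) L,
      ← measure_union₀ hY.nullMeasurableSet hXY]
    refine measure_mono (Set.union_subset ?_ ?_)
    · rintro _ ⟨x, hx, rfl⟩
      exact hC x (hKA hx) b (hLB hbL)
    · rintro _ ⟨y, hy, rfl⟩
      simpa [add_comm] using hC a (hKA haK) y (hLB hy)
  have hsup : ∀ {S : Set ℝ}, MeasurableSet S → volume S =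
      ⨆ K : {K : Set ℝ // K ⊆ S ∧ IsCompact K ∧ K.Nonempty}, volume K.1 := by
    intro S hS
    refine le_antisymm ?_ (iSup_le fun K => measure_mono K.2.1)
    rw [hS.measure_eq_iSup_isCompact]
    refine iSup_le fun K => iSup_le fun hKS => iSup_le fun hK => ?_
    rcases K.eq_empty_or_nonempty with rfl | hne
    · simp
    · exact le_iSup (fun K : {K : Set ℝ // K ⊆ S ∧ IsCompact K ∧ K.Nonempty} => volume K.1)
        ⟨K, hKS, hK, hne⟩
  have hne : ∀ {S : Set ℝ}, S.Nonempty →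
      Nonempty {K : Set ℝ // K ⊆ S ∧ IsCompact K ∧ K.Nonempty} := by
    rintro S ⟨x, hx⟩
    exact ⟨{x}, by simpa using hx, isCompact_singleton, Set.singleton_nonempty x⟩
  have := hne hAne
  have := hne hBne
  rw [hsup hA, hsup hB, ENNReal.mul_iSup, ENNReal.mul_iSup]
  exact ENNReal.iSup_add_iSup_le fun K L =>
    key K.1 K.2.1 L.1 L.2.1 K.2.2.1 L.2.2.1 K.2.2.2 L.2.2.2

/-- The layer cake formula on the line, for functions bounded by `1`. -/
theorem lintegral_eq_lintegral_volume_lt {f : ℝ → ℝ≥0∞} (hf : Measurable f)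
    (hf1 : ∀ x, f x ≤ 1) :
    ∫⁻ x, f x = ∫⁻ t in Set.Ioo (0 : ℝ) 1, volume {x | ENNReal.ofReal t < f x} := by
  have hfin : ∀ x, f x ≠ ∞ := fun x => ne_top_of_le_ne_top ENNReal.one_ne_top (hf1 x)
  have h := lintegral_eq_lintegral_meas_lt volume (f := fun x => (f x).toReal)
    (Filter.Eventually.of_forall fun x => ENNReal.toReal_nonneg) hf.ennreal_toReal.aemeasurable
  simp only [ENNReal.ofReal_toReal (hfin _)] at h
  rw [h, ← lintegral_indicator measurableSet_Ioi, ← lintegral_indicator measurableSet_Ioo]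
  refine lintegral_congr fun t => ?_
  simp only [Set.indicator_apply, Set.mem_Ioi, Set.mem_Ioo]
  by_cases h0 : 0 < t
  · by_cases h1 : t < 1
    · simp only [h0, h1, and_self, if_true, ENNReal.ofReal_lt_iff_lt_toReal h0.le (hfin _)]
    · have : {x | t < (f x).toReal} = ∅ := by
        ext x
        have := ENNReal.toReal_mono ENNReal.one_ne_top (hf1 x)
        rw [ENNReal.toReal_one] at this
        simpa using this.trans (not_lt.1 h1)
      simp [h0, h1, this]
  · simp [h0]

/-- The arithmetic form of the one-dimensional Prékopa–Leindler inequality, for functions whose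
supremum is `1`: it is the Brunn–Minkowski inequality of the superlevel sets, integrated over the
levels. -/
theorem lintegral_add_lintegral_le_of_iSup_eq_one {p q : ℝ} (hp : 0 < p) (hq : 0 < q)
    (hpq : p + q = 1) {f g h : ℝ → ℝ≥0∞} (hf : Measurable f) (hg : Measurable g)
    (hh : Measurable h) (hf1 : ⨆ x, f x = 1) (hg1 : ⨆ x, g x = 1)
    (H : ∀ x y, f x ^ p * g y ^ q ≤ h (p * x + q * y)) :
    ENNReal.ofReal p * (∫⁻ x, f x) + ENNReal.ofReal q * (∫⁻ x, g x) ≤ ∫⁻ x, h x := by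
  have hfle : ∀ x, f x ≤ 1 := fun x => hf1 ▸ le_iSup f x
  have hgle : ∀ x, g x ≤ 1 := fun x => hg1 ▸ le_iSup g x
  refine le_trans ?_ (lintegral_mono (fun x => min_le_left (h x) 1))
  rw [lintegral_eq_lintegral_volume_lt hf hfle, lintegral_eq_lintegral_volume_lt hg hgle,
    lintegral_eq_lintegral_volume_lt (hh.min measurable_const) (fun x => min_le_right _ _)]
  have hanti : ∀ k : ℝ → ℝ≥0∞, Measurable fun t : ℝ => volume {x | ENNReal.ofReal t < k x} :=
    fun k => Antitone.measurable fun s t hst => measure_mono fun x hx =>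
      lt_of_le_of_lt (ENNReal.ofReal_le_ofReal hst) hx
  rw [← lintegral_const_mul _ (hanti f), ← lintegral_const_mul _ (hanti g),
    ← lintegral_add_left ((hanti f).const_mul _)]
  refine setLIntegral_mono' measurableSet_Ioo fun t ht => ?_
  have ht1 : ENNReal.ofReal t < 1 := by simpa using ht.2
  refine volume_add_volume_le_of_combination_mem hp hq (hf measurableSet_Ioi)
    (hg measurableSet_Ioi) ?_ ?_ ?_
  · exact lt_iSup_iff.1 (hf1 ▸ ht1)
  · exact lt_iSup_iff.1 (hg1 ▸ ht1)
  · intro x hx y hy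
    refine lt_min (lt_of_lt_of_le ?_ (H x y)) ht1
    calc ENNReal.ofReal t = ENNReal.ofReal t ^ p * ENNReal.ofReal t ^ q := by
          rw [← ENNReal.rpow_add_of_nonneg _ _ hp.le hq.le, hpq, ENNReal.rpow_one]
      _ < f x ^ p * g y ^ q :=
          ENNReal.mul_lt_mul (ENNReal.rpow_lt_rpow hx hp) (ENNReal.rpow_lt_rpow hy hq)

/-- The weighted inequality of the arithmetic and geometric means in `ℝ≥0∞`. -/
theorem rpow_mul_rpow_le_add {p q : ℝ} (hp : 0 < p) (hq : 0 < q) (hpq : p + q = 1)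
    (a b : ℝ≥0∞) : a ^ p * b ^ q ≤ ENNReal.ofReal p * a + ENNReal.ofReal q * b := by
  have h := ENNReal.young_inequality (a ^ p) (b ^ q)
    (p := 1 / p) (q := 1 / q) ⟨by simpa using hpq, by positivity, by positivity⟩
  rw [← ENNReal.rpow_mul, ← ENNReal.rpow_mul, mul_one_div_cancel hp.ne',
    mul_one_div_cancel hq.ne', ENNReal.rpow_one, ENNReal.rpow_one, one_div, one_div,
    ENNReal.ofReal_inv_of_pos hp, ENNReal.ofReal_inv_of_pos hq, div_eq_mul_inv, div_eq_mul_inv,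
    inv_inv, inv_inv, mul_comm a, mul_comm b] at h
  exact h

/-- The one-dimensional Prékopa–Leindler inequality for bounded functions, which can be scaled to
have supremum `1`. -/
theorem prekopa_leindler_real_of_bounded {p q : ℝ} (hp : 0 < p) (hq : 0 < q)
    (hpq : p + q = 1) {f g h : ℝ → ℝ≥0∞} (hf : Measurable f) (hg : Measurable g)
    (hh : Measurable h) (hfb : ⨆ x, f x ≠ ∞) (hgb : ⨆ x, g x ≠ ∞)
    (H : ∀ x y, f x ^ p * g y ^ q ≤ h (p * x + q * y)) :
    (∫⁻ x, f x) ^ p * (∫⁻ x, g x) ^ q ≤ ∫⁻ x, h x := by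
  set a := ⨆ x, f x with ha
  set b := ⨆ x, g x with hb
  rcases eq_or_ne a 0 with ha0 | ha0
  · have : ∀ x, f x = 0 := fun x => le_antisymm (ha0 ▸ le_iSup f x) bot_le
    simp [this, hp]
  rcases eq_or_ne b 0 with hb0 | hb0
  · have : ∀ x, g x = 0 := fun x => le_antisymm (hb0 ▸ le_iSup g x) bot_le
    simp [this, hq]
  set c := a ^ p * b ^ q with hc
  have hc0 : c ≠ 0 := mul_ne_zero (by simp [ENNReal.rpow_eq_zero_iff, ha0, hfb])
    (by simp [ENNReal.rpow_eq_zero_iff, hb0, hgb])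
  have hct : c ≠ ∞ := ENNReal.mul_ne_top (ENNReal.rpow_ne_top_of_nonneg hp.le hfb)
    (ENNReal.rpow_ne_top_of_nonneg hq.le hgb)
  have key : ∀ u v : ℝ≥0∞, (u / a) ^ p * (v / b) ^ q = u ^ p * v ^ q / c := by
    intro u v
    rw [ENNReal.div_rpow_of_nonneg _ _ hp.le, ENNReal.div_rpow_of_nonneg _ _ hq.le, hc,
      div_eq_mul_inv, div_eq_mul_inv, div_eq_mul_inv, ENNReal.mul_inv]
    · ring
    · exact Or.inr (ENNReal.rpow_ne_top_of_nonneg hq.le hgb)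
    · exact Or.inl (ENNReal.rpow_ne_top_of_nonneg hp.le hfb)
  have h1 := lintegral_add_lintegral_le_of_iSup_eq_one hp hq hpq (hf.div_const a)
    (hg.div_const b) (hh.div_const c)
    (by rw [← ENNReal.iSup_div, ENNReal.div_self ha0 hfb])
    (by rw [← ENNReal.iSup_div, ENNReal.div_self hb0 hgb])
    (fun x y => by rw [key]; exact ENNReal.div_le_div_right (H x y) c)
  simp only [div_eq_mul_inv] at h1 key
  rw [lintegral_mul_const _ hf, lintegral_mul_const _ hg, lintegral_mul_const _ hh] at h1
  have h2 := (rpow_mul_rpow_le_add hp hq hpq _ _).trans h1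
  rw [key] at h2
  exact (ENNReal.mul_le_mul_iff_left (ENNReal.inv_ne_zero.2 hct) (ENNReal.inv_ne_top.2 hc0)).1 h2

theorem prekopa_leindler_real {p q : ℝ} (hp : 0 < p) (hq : 0 < q)
    (hpq : p + q = 1) {f g h : ℝ → ℝ≥0∞} (hf : Measurable f) (hg : Measurable g)
    (hh : Measurable h) (H : ∀ x y, f x ^ p * g y ^ q ≤ h (p * x + q * y)) :
    (∫⁻ x, f x) ^ p * (∫⁻ x, g x) ^ q ≤ ∫⁻ x, h x := by
  -- Truncate at height `N` and let `N` tend to infinity.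
  have hlim : ∀ {k : ℝ → ℝ≥0∞}, Measurable k → Filter.Tendsto
      (fun N : ℕ => ∫⁻ x, min (k x) N) Filter.atTop (nhds (∫⁻ x, k x)) := by
    intro k hk
    refine lintegral_tendsto_of_tendsto_of_monotone
      (fun N => (hk.min measurable_const).aemeasurable) (Filter.Eventually.of_forall fun x => ?_)
      (Filter.Eventually.of_forall fun x => ?_)
    · intro M N hMN
      exact min_le_min le_rfl (by exact_mod_cast hMN)
    · have := (tendsto_const_nhds (x := k x)).min ENNReal.tendsto_nat_nhds_top
      simpa using this
  have hb : ∀ (k : ℝ → ℝ≥0∞) (N : ℕ), ⨆ x, min (k x) N ≠ ∞ := fun k N =>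
    ne_top_of_le_ne_top (ENNReal.natCast_ne_top N) (iSup_le fun x => min_le_right _ _)
  have hN : ∀ N : ℕ, (∫⁻ x, min (f x) N) ^ p * (∫⁻ x, min (g x) N) ^ q ≤ ∫⁻ x, h x := fun N =>
    prekopa_leindler_real_of_bounded hp hq hpq (hf.min measurable_const)
      (hg.min measurable_const) hh (hb f N) (hb g N) fun x y =>
      le_trans (mul_le_mul' (ENNReal.rpow_le_rpow (min_le_left _ _) hp.le)
        (ENNReal.rpow_le_rpow (min_le_left _ _) hq.le)) (H x y)
  rcases eq_or_ne (∫⁻ x, f x) 0 with hf0 | hf0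
  · simp [hf0, hp]
  rcases eq_or_ne (∫⁻ x, g x) 0 with hg0 | hg0
  · simp [hg0, hq]
  refine le_of_tendsto' (ENNReal.Tendsto.mul ((hlim hf).ennrpow_const p) (Or.inl ?_)
    ((hlim hg).ennrpow_const q) (Or.inl ?_)) hN
  · simp [ENNReal.rpow_eq_zero_iff, hf0, hp.le]
  · simp [ENNReal.rpow_eq_zero_iff, hg0, hq.le]

/-- The Prékopa–Leindler inequality, with weights `p + q = 1`. -/
theorem prekopa_leindler {p q : ℝ} (hp : 0 < p) (hq : 0 < q) (hpq : p + q = 1) (n : ℕ)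
    {f g h : (Fin n → ℝ) → ℝ≥0∞} (hf : Measurable f) (hg : Measurable g) (hh : Measurable h)
    (H : ∀ x y, f x ^ p * g y ^ q ≤ h (p • x + q • y)) :
    (∫⁻ x, f x) ^ p * (∫⁻ x, g x) ^ q ≤ ∫⁻ x, h x := by
  induction n with
  | zero =>
    simp only [Measure.volume_pi_eq_dirac (fun _ : Fin 0 => (0 : ℝ)),
      lintegral_dirac' _ hf, lintegral_dirac' _ hg, lintegral_dirac' _ hh]
    refine (H _ _).trans (le_of_eq (congrArg h (Subsingleton.elim _ _)))
  | succ n ih =>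
    set e := MeasurableEquiv.piFinSuccAbove (fun _ : Fin (n + 1) => ℝ) 0
    have hfubini : ∀ {k : (Fin (n + 1) → ℝ) → ℝ≥0∞}, Measurable k →
        ∫⁻ x, k x = ∫⁻ s : ℝ, ∫⁻ x : Fin n → ℝ, k (e.symm (s, x)) := by
      intro k hk
      rw [← ((volume_preserving_piFinSuccAbove (fun _ : Fin (n + 1) => ℝ) 0).symm
        e).lintegral_comp hk, Measure.volume_eq_prod,
        lintegral_prod (fun z => k (e.symm z)) (hk.comp e.symm.measurable).aemeasurable]
    have hslice : ∀ {k : (Fin (n + 1) → ℝ) → ℝ≥0∞}, Measurable k → ∀ s : ℝ,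
        Measurable fun x : Fin n → ℝ => k (e.symm (s, x)) := fun hk s =>
      hk.comp (e.symm.measurable.comp measurable_prodMk_left)
    have hint : ∀ {k : (Fin (n + 1) → ℝ) → ℝ≥0∞}, Measurable k →
        Measurable fun s : ℝ => ∫⁻ x : Fin n → ℝ, k (e.symm (s, x)) := fun hk =>
      (hk.comp e.symm.measurable).lintegral_prod_right'
    rw [hfubini hf, hfubini hg, hfubini hh]
    refine prekopa_leindler_real hp hq hpq (hint hf) (hint hg) (hint hh) fun s t => ?_
    refine ih (hslice hf s) (hslice hg t) (hslice hh _) fun x y => ?_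
    refine (H _ _).trans (le_of_eq (congrArg h ?_))
    ext i
    refine Fin.cases ?_ (fun j => ?_) i <;>
      simp [e, MeasurableEquiv.piFinSuccAbove]

/-! ### The Brunn–Minkowski inequality -/

/-- The multiplicative, dimension-free form of the Brunn–Minkowski inequality. -/
theorem volume_rpow_mul_le {n : ℕ} {p q : ℝ} (hp : 0 < p) (hq : 0 < q) (hpq : p + q = 1)
    {A B C : Set (EuclideanSpace ℝ (Fin n))} (hA : MeasurableSet A) (hB : MeasurableSet B)
    (hC : MeasurableSet C) (H : ∀ x ∈ A, ∀ y ∈ B, p • x + q • y ∈ C) :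
    volume A ^ p * volume B ^ q ≤ volume C := by
  have hvol : ∀ {S : Set (EuclideanSpace ℝ (Fin n))}, MeasurableSet S →
      volume S = ∫⁻ x : Fin n → ℝ, S.indicator (fun _ => (1 : ℝ≥0∞)) (WithLp.toLp 2 x) := by
    intro S hS
    rw [(PiLp.volume_preserving_toLp (Fin n)).lintegral_comp (measurable_const.indicator hS),
      lintegral_indicator_const hS, one_mul]
  have hmeas : ∀ {S : Set (EuclideanSpace ℝ (Fin n))}, MeasurableSet S →
      Measurable fun x : Fin n → ℝ => S.indicator (fun _ => (1 : ℝ≥0∞)) (WithLp.toLp 2 x) := fun hS =>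
    (measurable_const.indicator hS).comp (PiLp.volume_preserving_toLp (Fin n)).measurable
  rw [hvol hA, hvol hB, hvol hC]
  refine prekopa_leindler hp hq hpq n (hmeas hA) (hmeas hB) (hmeas hC) fun x y => ?_
  by_cases hx : WithLp.toLp 2 x ∈ A
  · by_cases hy : WithLp.toLp 2 y ∈ B
    · have := H _ hx _ hy
      simp [hx, hy, this]
    · simp [hy, hq]
  · simp [hx, hp]

/-- The Brunn–Minkowski inequality `|p A + q B|^(1/n) ≥ p |A|^(1/n) + q |B|^(1/n)`, where `A` has
volume `1` and `a` is the `n`-th root of the volume of `B`. -/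
theorem brunn_minkowski {n : ℕ} {p q a : ℝ} (hp : 0 < p) (hq : 0 < q) (ha : 0 < a)
    {A B C : Set (EuclideanSpace ℝ (Fin n))} (hA : MeasurableSet A) (hB : MeasurableSet B)
    (hC : MeasurableSet C) (hA1 : volume A = 1) (hBa : volume B = ENNReal.ofReal (a ^ n))
    (H : ∀ x ∈ A, ∀ y ∈ B, p • x + q • y ∈ C) :
    ENNReal.ofReal ((p + q * a) ^ n) ≤ volume C := by
  -- The multiplicative inequality, for `A`, `B / a` and `C / (p + q a)`, two of volume `1`.
  set c := p + q * a with hc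
  have hc0 : 0 < c := by positivity
  have hscale : ∀ r : ℝ, 0 < r → ∀ S : Set (EuclideanSpace ℝ (Fin n)),
      ENNReal.ofReal (r ^ n) * volume ((fun x => r • x) ⁻¹' S) = volume S := by
    intro r hr S
    rw [Measure.addHaar_preimage_smul _ hr.ne', ← mul_assoc, ← ENNReal.ofReal_mul (by positivity),
      finrank_euclideanSpace_fin, abs_of_pos (by positivity),
      mul_inv_cancel₀ (by positivity), ENNReal.ofReal_one, one_mul]
  have hB1 : volume ((fun x : EuclideanSpace ℝ (Fin n) => a • x) ⁻¹' B) = 1 := by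
    have h := hscale a ha B
    rw [hBa] at h
    refine (ENNReal.mul_right_inj (c := 1) ?_ ENNReal.ofReal_ne_top).1 (by rw [h, mul_one])
    simpa using pow_pos ha n
  have h := volume_rpow_mul_le (p := p / c) (q := q * a / c) (by positivity) (by positivity)
    (by rw [← add_div, ← hc, div_self hc0.ne']) hA
    (hB.preimage (measurable_const_smul a)) (hC.preimage (measurable_const_smul c)) (by
      intro x hx y hy
      have := H x hx _ hy
      rw [Set.mem_preimage, smul_add, smul_smul, smul_smul, mul_div_cancel₀ _ hc0.ne',
        mul_div_cancel₀ _ hc0.ne', mul_smul]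
      exact this)
  rw [hA1, hB1, ENNReal.one_rpow, ENNReal.one_rpow, one_mul] at h
  calc ENNReal.ofReal (c ^ n) = ENNReal.ofReal (c ^ n) * 1 := (mul_one _).symm
    _ ≤ ENNReal.ofReal (c ^ n) * volume ((fun x => c • x) ⁻¹' C) := by gcongr
    _ = volume C := hscale c hc0 C

/-! ### Cones over a horizontal base -/

variable {d : ℕ} {F G : Set (EuclideanSpace ℝ (Fin (d - 1)))} {K M : Set (Space d)}

/-- The points strictly between the heights `0` and `z.2` on the segments that join the apex `z`
to the points of `G × {0}`. The point of `G` is written as a function of the point of the cone, so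
that the relation "`p` is in the cone with apex `z`" is visibly measurable in `(p, z)`. -/
def openCone (G : Set (EuclideanSpace ℝ (Fin (d - 1)))) (z : Space d) : Set (Space d) :=
  {p | 0 < p.2 ∧ p.2 < z.2 ∧ (1 - p.2 / z.2)⁻¹ • (p.1 - (p.2 / z.2) • z.1) ∈ G}

theorem openCone_mono (h : F ⊆ G) (z : Space d) : openCone F z ⊆ openCone G z :=
  fun _ hp => ⟨hp.1, hp.2.1, h hp.2.2⟩

theorem measurableSet_mem_openCone (hG : MeasurableSet G) :
    MeasurableSet {u : Space d × Space d | u.1 ∈ openCone G u.2} := by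
  have h1 : Measurable fun u : Space d × Space d => u.1.2 := by fun_prop
  have h2 : Measurable fun u : Space d × Space d => u.2.2 := by fun_prop
  refine (measurableSet_lt measurable_const h1).inter ((measurableSet_lt h1 h2).inter ?_)
  have : Measurable fun u : Space d × Space d =>
      (1 - u.1.2 / u.2.2)⁻¹ • (u.1.1 - (u.1.2 / u.2.2) • u.2.1) := by fun_prop
  exact this hG

theorem measurableSet_openCone (hG : MeasurableSet G) (z : Space d) :
    MeasurableSet (openCone G z) :=
  measurable_prodMk_right (y := z) (measurableSet_mem_openCone hG)

theorem isOpen_openCone (hG : IsOpen G) (z : Space d) : IsOpen (openCone G z) := by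
  rw [isOpen_iff_mem_nhds]
  rintro p ⟨h0, h1, hp⟩
  have hz : 0 < z.2 := h0.trans h1
  have hne : 1 - p.2 / z.2 ≠ 0 := by
    have := (div_lt_one hz).2 h1
    linarith
  have hc : ContinuousAt
      (fun p : Space d => (1 - p.2 / z.2)⁻¹ • (p.1 - (p.2 / z.2) • z.1)) p := by
    have h : Continuous fun p : Space d => 1 - p.2 / z.2 := by fun_prop
    exact (h.continuousAt.inv₀ hne).smul (by fun_prop)
  filter_upwards [continuousAt_snd.eventually (lt_mem_nhds h0),
    continuousAt_snd.eventually (gt_mem_nhds h1), hc (hG.mem_nhds hp)] with q h2 h3 h4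
  exact ⟨h2, h3, h4⟩

theorem volume_openCone_slice (G : Set (EuclideanSpace ℝ (Fin (d - 1)))) (z : Space d) {t : ℝ}
    (h0 : 0 < t) (h1 : t < z.2) :
    volume {x | (x, t) ∈ openCone G z} =
      ENNReal.ofReal ((1 - t / z.2) ^ (d - 1)) * volume G := by
  have hc : 0 < 1 - t / z.2 := by
    have := (div_lt_one (h0.trans h1)).2 h1
    linarith
  have : {x | (x, t) ∈ openCone G z} =
      (fun x => x + -((t / z.2) • z.1)) ⁻¹' ((fun x => (1 - t / z.2)⁻¹ • x) ⁻¹' G) := by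
    ext x
    simp [openCone, h0, h1, sub_eq_add_neg]
  rw [this, measure_preimage_add_right, Measure.addHaar_preimage_smul _ (inv_ne_zero hc.ne'),
    finrank_euclideanSpace_fin, inv_pow, inv_inv, abs_of_pos (by positivity)]

theorem integral_one_sub_div_pow (n : ℕ) {h : ℝ} (hh : 0 < h) :
    ∫ t in (0 : ℝ)..h, (1 - t / h) ^ n = h / (n + 1) := by
  have h1 := intervalIntegral.integral_comp_sub_div (a := 0) (b := h)
    (fun x : ℝ => x ^ n) hh.ne' 1
  rw [h1, div_self hh.ne', integral_pow]
  simp [div_eq_mul_inv]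

theorem cast_pred_add_one (hd : 1 ≤ d) : ((d - 1 : ℕ) : ℝ) + 1 = d := by
  rw [Nat.cast_sub hd, Nat.cast_one, sub_add_cancel]

/-- The volume of a cone: height times area of the base over `d`. Both sides vanish when the height
is nonpositive. -/
theorem volume_openCone (hd : 1 ≤ d) (hG : MeasurableSet G) (z : Space d) :
    volume (openCone G z) = ENNReal.ofReal (z.2 / d) * volume G := by
  rcases le_or_gt z.2 0 with hz | hz
  · have : openCone G z = ∅ := by
      ext p
      simp only [openCone, Set.mem_ofPred_eq, Set.mem_empty_iff_false, iff_false]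
      rintro ⟨h0, h1, -⟩
      linarith
    rw [this, measure_empty, ENNReal.ofReal_of_nonpos, zero_mul]
    exact div_nonpos_of_nonpos_of_nonneg hz (Nat.cast_nonneg d)
  have hslice : ∀ t : ℝ, volume ((fun x => (x, t)) ⁻¹' openCone G z) =
      (Set.Ioo 0 z.2).indicator
        (fun t => ENNReal.ofReal ((1 - t / z.2) ^ (d - 1)) * volume G) t := by
    intro t
    by_cases ht : t ∈ Set.Ioo 0 z.2
    · rw [Set.indicator_of_mem ht]
      exact volume_openCone_slice G z ht.1 ht.2
    · rw [Set.indicator_of_notMem ht]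
      have : (fun x => (x, t)) ⁻¹' openCone G z = ∅ := by
        ext x
        simp only [Set.mem_preimage, Set.mem_empty_iff_false, iff_false]
        exact fun h => ht ⟨h.1, h.2.1⟩
      rw [this, measure_empty]
  rw [Measure.volume_eq_prod, Measure.prod_apply_symm (measurableSet_openCone hG z)]
  simp only [hslice]
  rw [lintegral_indicator measurableSet_Ioo, lintegral_mul_const _ (by fun_prop),
    setLIntegral_congr Ioo_ae_eq_Ioc, ← ofReal_integral_eq_lintegral_ofReal,
    ← intervalIntegral.integral_of_le hz.le, integral_one_sub_div_pow _ hz,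
    cast_pred_add_one hd]
  · exact (Continuous.integrableOn_Icc (by fun_prop)).mono_set Set.Ioc_subset_Icc_self
  · refine (ae_restrict_mem measurableSet_Ioc).mono fun t ht => ?_
    have : t / z.2 ≤ 1 := (div_le_one hz).2 ht.2
    exact pow_nonneg (by linarith) _

/-! ### Membership in mountains and in their interiors -/

theorem convex_base (hF : Convex ℝ F) : Convex ℝ (base (d := d) F) :=
  hF.prod (convex_singleton 0)

theorem mem_mountain_iff (hF : Convex ℝ F) (hne : F.Nonempty) {z p : Space d} :
    p ∈ mountain F z ↔
      ∃ y ∈ F, ∃ s : ℝ, 0 ≤ s ∧ s ≤ 1 ∧ p.1 = s • z.1 + (1 - s) • y ∧ p.2 = s * z.2 := by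
  have hbne : (base (d := d) F).Nonempty := hne.prod (Set.singleton_nonempty 0)
  rw [mountain, Set.singleton_union, convexHull_insert hbne, (convex_base hF).convexHull_eq,
    convexJoin_singleton_left]
  simp only [Set.mem_iUnion, segment, Set.mem_ofPred_eq]
  constructor
  · rintro ⟨⟨y, c⟩, ⟨hy, hc⟩, s, r, hs, hr, hsr, rfl⟩
    obtain rfl : c = 0 := hc
    obtain rfl : r = 1 - s := by linarith
    exact ⟨y, hy, s, hs, by linarith, by simp, by simp⟩
  · rintro ⟨y, hy, s, hs, hs1, h1, h2⟩
    refine ⟨(y, 0), ⟨hy, rfl⟩, s, 1 - s, hs, by linarith, by ring, ?_⟩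
    ext1
    · simp [h1]
    · simp [h2]

theorem openCone_subset_mountain (hF : Convex ℝ F) (z : Space d) :
    openCone F z ⊆ mountain F z := by
  rintro p ⟨h0, h1, hp⟩
  have hz := h0.trans h1
  have hlt := (div_lt_one hz).2 h1
  refine (mem_mountain_iff hF ⟨_, hp⟩).2
    ⟨_, hp, p.2 / z.2, by positivity, hlt.le, ?_, (div_mul_cancel₀ _ hz.ne').symm⟩
  rw [smul_smul, mul_inv_cancel₀ (by linarith), one_smul]
  abel

theorem mem_openCone_of_mem_mountain (hF : Convex ℝ F) (hne : F.Nonempty) {z p : Space d}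
    (hp : p ∈ mountain F z) (h0 : 0 < p.2) (hz : 0 < z.2) (hpz : p.2 ≠ z.2) :
    p ∈ openCone F z := by
  obtain ⟨y, hy, s, hs, hs1, h1, h2⟩ := (mem_mountain_iff hF hne).1 hp
  have hs' : s < 1 := lt_of_le_of_ne hs1 fun h => hpz (by rw [h2, h, one_mul])
  have hdiv : p.2 / z.2 = s := by rw [h2, mul_div_cancel_right₀ _ hz.ne']
  refine ⟨h0, ?_, ?_⟩
  · rw [h2]
    exact mul_lt_of_lt_one_left hz hs'
  · rw [hdiv, h1, add_sub_cancel_left, smul_smul, inv_mul_cancel₀ (by linarith), one_smul]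
    exact hy

/-- A point of the interior of the hull of a convex set `M` and that point lies in `M`: otherwise
it would be an extreme point of the hull. -/
theorem mem_of_mem_interior_convexHull_insert {V : Type*} [AddCommGroup V] [Module ℝ V]
    [TopologicalSpace V] [IsTopologicalAddGroup V] [ContinuousSMul ℝ V] {M : Set V} {u : V}
    (hM : Convex ℝ M) (hne : M.Nonempty) (hu : u ∈ interior (convexHull ℝ (insert u M))) :
    u ∈ M := by
  obtain ⟨b, hb⟩ := hne
  -- Move `u` slightly away from `b`, within the hull.
  have hcont : Filter.Tendsto (fun ε : ℝ => u + ε • (u - b)) (nhdsWithin 0 (Set.Ioi 0))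
      (nhds u) := by
    have : Continuous fun ε : ℝ => u + ε • (u - b) := by fun_prop
    simpa using (this.tendsto 0).mono_left nhdsWithin_le_nhds
  obtain ⟨ε, hmem, hpos⟩ := ((hcont.eventually (mem_interior_iff_mem_nhds.1 hu)).and
    self_mem_nhdsWithin).exists
  have hε0 : 0 < ε := hpos
  have hε : u + ε • (u - b) ∈ convexHull ℝ (insert u M) := hmem
  rw [convexHull_insert ⟨b, hb⟩, hM.convexHull_eq,
    convexJoin_singleton_left] at hε
  simp only [Set.mem_iUnion, segment, Set.mem_ofPred_eq] at hε
  obtain ⟨m, hm, r, s, hr, hs, hrs, h⟩ := hε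
  have hu' : u = (s / (s + ε)) • m + (ε / (s + ε)) • b := by
    have hne : s + ε ≠ 0 := by positivity
    have h3 : (s + ε) • u = s • m + ε • b := by
      obtain rfl : r = 1 - s := by linarith
      have h4 : s • m = u + ε • (u - b) - (1 - s) • u := by rw [← h]; abel
      rw [h4]
      module
    rw [div_eq_inv_mul, div_eq_inv_mul, mul_smul, mul_smul, ← smul_add, ← h3, smul_smul,
      inv_mul_cancel₀ hne, one_smul]
  rw [hu']
  exact hM hm hb (by positivity) (by positivity) (by field_simp)

theorem volume_setOf_height_eq (c : ℝ) : volume {p : Space d | p.2 = c} = 0 := by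
  have : {p : Space d | p.2 = c} = Set.univ ×ˢ {c} := by ext p; simp
  rw [this, Measure.volume_eq_prod, Measure.prod_prod]
  simp

/-- In general position, `u` is interior to the hull of the floor, `u` and `v` if and only if it
belongs to the mountain with apex `v`. -/
theorem mem_interior_convexHull_iff (hF : Convex ℝ F) (hne : F.Nonempty) {u v : Space d}
    (hu : 0 < u.2) (hv : 0 < v.2) (huv : u.2 ≠ v.2) (hfr : u ∉ openCone (frontier F) v) :
    u ∈ interior (convexHull ℝ (base F ∪ {u, v})) ↔ u ∈ openCone F v := by
  have hMC : mountain F v ⊆ convexHull ℝ (base F ∪ {u, v}) :=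
    convexHull_mono (by intro p; simp only [Set.mem_union, Set.mem_insert_iff]; tauto)
  constructor
  · intro h
    refine mem_openCone_of_mem_mountain hF hne ?_ hu hv huv
    refine mem_of_mem_interior_convexHull_insert (convex_convexHull ℝ _) ?_
      (interior_mono (convexHull_mono ?_) h)
    · exact ⟨v, subset_convexHull ℝ _ (Or.inl rfl)⟩
    · rintro p (hp | rfl | rfl)
      · exact Or.inr (subset_convexHull ℝ _ (Or.inr hp))
      · exact Or.inl rfl
      · exact Or.inr (subset_convexHull ℝ _ (Or.inl rfl))
  · intro h
    have hint : u ∈ openCone (interior F) v := by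
      refine ⟨h.1, h.2.1, ?_⟩
      by_contra hn
      exact hfr ⟨h.1, h.2.1, subset_closure h.2.2, hn⟩
    refine mem_interior.2 ⟨_, ?_, isOpen_openCone isOpen_interior v, hint⟩
    exact (openCone_mono interior_subset v).trans ((openCone_subset_mountain hF v).trans hMC)

theorem mem_frontier_and_mem_frontier_iff (hF : Convex ℝ F) (hne : F.Nonempty) {u v : Space d}
    (hu : 0 < u.2) (hv : 0 < v.2) (huv : u.2 ≠ v.2) (hfr : u ∉ openCone (frontier F) v)
    (hfr' : v ∉ openCone (frontier F) u) :
    (u ∈ frontier (convexHull ℝ (base F ∪ {u, v})) ∧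
      v ∈ frontier (convexHull ℝ (base F ∪ {u, v}))) ↔
      ¬ (u ∈ openCone F v ∨ v ∈ openCone F u) := by
  have h1 := mem_interior_convexHull_iff hF hne hu hv huv hfr
  have h2 := mem_interior_convexHull_iff hF hne hv hu huv.symm hfr'
  rw [Set.pair_comm v u] at h2
  have h3 : u ∈ closure (convexHull ℝ (base F ∪ {u, v})) :=
    subset_closure (subset_convexHull ℝ _ (by simp))
  have h4 : v ∈ closure (convexHull ℝ (base F ∪ {u, v})) :=
    subset_closure (subset_convexHull ℝ _ (by simp))
  simp only [frontier, Set.mem_sdiff, h1, h2, h3, h4, true_and, not_or]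

/-! ### The probability as a function of the mean height -/

/-- Almost every pair of points of positive height is in general position with respect to the
floor. -/
theorem ae_general_position (hd : 1 ≤ d) (hF : Convex ℝ F) :
    ∀ᵐ u : Space d × Space d, u.1.2 ≠ 0 ∧ u.2.2 ≠ 0 ∧ u.1.2 ≠ u.2.2 ∧
      u.1 ∉ openCone (frontier F) u.2 ∧ u.2 ∉ openCone (frontier F) u.1 := by
  have hheight : ∀ c : ℝ, ∀ᵐ p : Space d, p.2 ≠ c := fun c => by
    rw [ae_iff]
    simpa using volume_setOf_height_eq c
  have hcone : ∀ z : Space d, volume (openCone (frontier F) z) = 0 := fun z => by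
    rw [volume_openCone hd isClosed_frontier.measurableSet, hF.addHaar_frontier volume, mul_zero]
  have hmeas := measurableSet_mem_openCone (d := d) (isClosed_frontier (s := F)).measurableSet
  have h1 : ∀ᵐ u : Space d × Space d, u.1.2 ≠ 0 :=
    Measure.quasiMeasurePreserving_fst.ae (hheight 0)
  have h2 : ∀ᵐ u : Space d × Space d, u.2.2 ≠ 0 :=
    Measure.quasiMeasurePreserving_snd.ae (hheight 0)
  have h3 : ∀ᵐ u : Space d × Space d, u.1.2 ≠ u.2.2 := by
    rw [Measure.volume_eq_prod, Measure.ae_prod_iff_ae_ae]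
    · exact Filter.Eventually.of_forall fun p => (hheight p.2).mono fun q hq => hq.symm
    · exact (measurableSet_eq_fun (by fun_prop) (by fun_prop)).compl
  have h5 : ∀ᵐ u : Space d × Space d, u.2 ∉ openCone (frontier F) u.1 := by
    rw [Measure.volume_eq_prod, Measure.ae_prod_iff_ae_ae]
    · exact Filter.Eventually.of_forall fun p => measure_eq_zero_iff_ae_notMem.1 (hcone p)
    · exact (measurable_swap hmeas).compl
  have h4 : ∀ᵐ u : Space d × Space d, u.1 ∉ openCone (frontier F) u.2 :=
    (Measure.measurePreserving_swap (μ := (volume : Measure (Space d)))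
      (ν := (volume : Measure (Space d)))).quasiMeasurePreserving.ae h5
  filter_upwards [h1, h2, h3, h4, h5] with u a b c e f using ⟨a, b, c, e, f⟩

/-- The probability of the convex position of two points is governed by the mean height: each of
the two points fails with probability `E[volume of the mountain with apex U] = E[height of U] / d`,
and they do not fail together. -/
theorem Q_eq_one_sub_mean_height (hd : 1 ≤ d) (hFc : IsCompact F) (hF : Convex ℝ F)
    (hF1 : volume F = 1) (hKc : IsCompact K) (hK : Convex ℝ K) (hbase : base F ⊆ K)
    (hnonneg : ∀ p ∈ K, 0 ≤ p.2) (hK1 : volume K = 1) :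
    Q F K = 1 - 2 / d * ∫ p in K, p.2 := by
  have hne : F.Nonempty := by
    rw [Set.nonempty_iff_ne_empty]
    rintro rfl
    simp at hF1
  set μ : Measure (Space d) := volume.restrict K with hμ
  have huniform : uniform K = μ := by
    simp [uniform, ProbabilityTheory.cond, hK1, hμ]
  have : IsProbabilityMeasure μ := ⟨by rw [hμ, Measure.restrict_apply_univ, hK1]⟩
  set D : Set (Space d × Space d) := {u | u.1 ∈ openCone F u.2} with hD
  set D' : Set (Space d × Space d) := {u | u.2 ∈ openCone F u.1} with hD'
  have hDm : MeasurableSet D := measurableSet_mem_openCone hFc.measurableSet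
  have hDm' : MeasurableSet D' := measurable_swap hDm
  have hcone : ∀ p ∈ K, μ (openCone F p) = ENNReal.ofReal (p.2 / d) := by
    intro p hp
    have hsub : openCone F p ⊆ K := (openCone_subset_mountain hF p).trans
      (convexHull_min (Set.union_subset (by simpa using hp) hbase) hK)
    rw [hμ, Measure.restrict_apply (measurableSet_openCone hFc.measurableSet p),
      Set.inter_eq_left.2 hsub, volume_openCone hd hFc.measurableSet, hF1, mul_one]
  have hint : ∫⁻ p, μ (openCone F p) ∂μ = ENNReal.ofReal ((∫ p in K, p.2) / d) := by
    rw [hμ, setLIntegral_congr_fun hKc.measurableSet hcone, ← integral_div,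
      ofReal_integral_eq_lintegral_ofReal]
    · exact ContinuousOn.integrableOn_compact hKc (by fun_prop)
    · refine (ae_restrict_mem hKc.measurableSet).mono fun p hp => ?_
      exact div_nonneg (hnonneg p hp) (Nat.cast_nonneg d)
  have hmean : 0 ≤ (∫ p in K, p.2) / d :=
    div_nonneg (setIntegral_nonneg hKc.measurableSet hnonneg) (Nat.cast_nonneg d)
  have hDμ : (μ.prod μ).real D = (∫ p in K, p.2) / d := by
    rw [Measure.real, Measure.prod_apply_symm hDm]
    exact (congrArg ENNReal.toReal hint).trans (ENNReal.toReal_ofReal hmean)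
  have hDμ' : (μ.prod μ).real D' = (∫ p in K, p.2) / d := by
    rw [Measure.real, Measure.prod_apply hDm']
    exact (congrArg ENNReal.toReal hint).trans (ENNReal.toReal_ofReal hmean)
  have hdisj : Disjoint D D' := by
    rw [Set.disjoint_left]
    intro u h1 h2
    exact lt_asymm h1.2.1 h2.2.1
  have hae : {u : Space d × Space d | u.1 ∈ frontier (convexHull ℝ (base F ∪ {u.1, u.2})) ∧
      u.2 ∈ frontier (convexHull ℝ (base F ∪ {u.1, u.2}))} =ᵐ[μ.prod μ]
      ((D ∪ D')ᶜ : Set (Space d × Space d)) := by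
    rw [hμ, Measure.prod_restrict]
    filter_upwards [ae_restrict_of_ae (ae_general_position hd hF),
      ae_restrict_mem (hKc.measurableSet.prod hKc.measurableSet)] with u hu huK
    refine propext ?_
    exact mem_frontier_and_mem_frontier_iff hF hne
      (lt_of_le_of_ne (hnonneg _ huK.1) hu.1.symm) (lt_of_le_of_ne (hnonneg _ huK.2) hu.2.1.symm)
      hu.2.2.1 hu.2.2.2.1 hu.2.2.2.2
  rw [Q, huniform, measureReal_congr hae, probReal_compl_eq_one_sub (hDm.union hDm'),
    measureReal_union hdisj hDm', hDμ, hDμ']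
  ring

/-! ### Horizontal sections and comparison of first moments -/

/-- The `(d - 1)`-dimensional volume of the horizontal section of `K` at height `t`. -/
noncomputable def area (K : Set (Space d)) (t : ℝ) : ℝ :=
  volume.real {x | (x, t) ∈ K}

theorem area_nonneg (K : Set (Space d)) (t : ℝ) : 0 ≤ area K t := measureReal_nonneg

theorem area_eq_zero {t : ℝ} (h : ∀ x, (x, t) ∉ K) : area K t = 0 := by
  have : {x | (x, t) ∈ K} = ∅ := Set.eq_empty_of_forall_notMem h
  rw [area, this, measureReal_empty]

theorem measurableSet_section (hK : MeasurableSet K) (t : ℝ) :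
    MeasurableSet {x | (x, t) ∈ K} :=
  measurable_prodMk_right (y := t) hK

theorem integral_indicator_height (hK : MeasurableSet K) (f : ℝ → ℝ) (t : ℝ) :
    ∫ x, K.indicator (fun p => f p.2) (x, t) = f t * area K t := by
  have : (fun x => K.indicator (fun p => f p.2) (x, t)) =
      {x | (x, t) ∈ K}.indicator fun _ => f t := by
    ext x
    by_cases h : (x, t) ∈ K
    · rw [Set.indicator_of_mem h, Set.indicator_of_mem (Set.mem_ofPred_eq ▸ h)]
    · rw [Set.indicator_of_notMem h, Set.indicator_of_notMem (by simpa using h)]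
  rw [this, integral_indicator_const _ (measurableSet_section hK t), smul_eq_mul, mul_comm, area]

theorem setIntegral_height (hK : MeasurableSet K) {f : ℝ → ℝ}
    (hf : IntegrableOn (fun p => f p.2) K) :
    ∫ p in K, f p.2 = ∫ t, f t * area K t := by
  rw [← integral_indicator hK, Measure.volume_eq_prod,
    integral_prod_symm _ (by rwa [← Measure.volume_eq_prod, integrable_indicator_iff hK])]
  simp only [integral_indicator_height hK]

theorem integrable_mul_area (hK : MeasurableSet K) {f : ℝ → ℝ}
    (hf : IntegrableOn (fun p => f p.2) K) : Integrable fun t => f t * area K t := by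
  have h : Integrable (K.indicator fun p => f p.2) (volume.prod volume) := by
    rwa [← Measure.volume_eq_prod, integrable_indicator_iff hK]
  simpa only [integral_indicator_height hK] using h.integral_prod_right

/-- Two densities of the same mass whose difference changes sign once, from nonnegative to
nonpositive at `c`, have ordered first moments. -/
theorem integral_mul_le_of_single_crossing {a b : ℝ → ℝ} (c : ℝ) (ha : Integrable a)
    (hb : Integrable b) (hta : Integrable fun t => t * a t) (htb : Integrable fun t => t * b t)
    (hab : ∫ t, a t = ∫ t, b t) (h1 : ∀ t < c, b t ≤ a t) (h2 : ∀ t, c < t → a t ≤ b t) :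
    ∫ t, t * a t ≤ ∫ t, t * b t := by
  have h : ∀ t, t * a t - c * a t ≤ t * b t - c * b t := by
    intro t
    rcases lt_trichotomy t c with h | rfl | h
    · nlinarith [h1 t h]
    · simp
    · nlinarith [h2 t h]
  have h3 := integral_mono (hta.sub (ha.const_mul c)) (htb.sub (hb.const_mul c)) h
  simp only [Pi.sub_apply] at h3
  rw [integral_sub hta (ha.const_mul c), integral_sub htb (hb.const_mul c), integral_const_mul,
    integral_const_mul, hab] at h3
  linarith

/-! ### Volume, sections and mean height of mountains -/

/-- The area at height `t` of a mountain of volume `1` over a floor of area `1`, which has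
height `d`. The end points are left out. -/
noncomputable def mountainArea (d : ℕ) : ℝ → ℝ :=
  (Set.Ioo 0 (d : ℝ)).indicator fun t => (1 - t / d) ^ (d - 1)

theorem area_openCone (hF1 : volume F = 1) {z : Space d} (hz : z.2 = d) (t : ℝ) :
    area (openCone F z) t = mountainArea d t := by
  by_cases ht : t ∈ Set.Ioo 0 (d : ℝ)
  · rw [mountainArea, Set.indicator_of_mem ht, area, Measure.real,
      volume_openCone_slice F z ht.1 (hz ▸ ht.2), hF1, mul_one, hz, ENNReal.toReal_ofReal]
    have := (div_le_one (ht.1.trans ht.2)).2 ht.2.le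
    exact pow_nonneg (by linarith) _
  · rw [mountainArea, Set.indicator_of_notMem ht]
    exact area_eq_zero fun x hx => ht ⟨hx.1, hz ▸ hx.2.1⟩

theorem mountainArea_nonneg (d : ℕ) (t : ℝ) : 0 ≤ mountainArea d t := by
  refine Set.indicator_nonneg (fun t ht => ?_) t
  have := (div_le_one (ht.1.trans ht.2)).2 ht.2.le
  exact pow_nonneg (by linarith) _

theorem mul_mountainArea (f : ℝ → ℝ) (d : ℕ) :
    (fun t => f t * mountainArea d t) =
      (Set.Ioo 0 (d : ℝ)).indicator fun t => f t * (1 - t / d) ^ (d - 1) := by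
  ext t
  simp only [mountainArea, Set.indicator_apply]
  split_ifs <;> simp

theorem integrable_mul_mountainArea {f : ℝ → ℝ} (hf : Continuous f) (d : ℕ) :
    Integrable fun t => f t * mountainArea d t := by
  rw [mul_mountainArea, integrable_indicator_iff measurableSet_Ioo]
  exact (Continuous.integrableOn_Icc (by fun_prop)).mono_set Set.Ioo_subset_Icc_self

theorem integral_mul_mountainArea (f : ℝ → ℝ) (d : ℕ) :
    ∫ t, f t * mountainArea d t = ∫ t in (0 : ℝ)..d, f t * (1 - t / d) ^ (d - 1) := by
  rw [mul_mountainArea, integral_indicator measurableSet_Ioo,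
    intervalIntegral.integral_of_le (Nat.cast_nonneg d), integral_Ioc_eq_integral_Ioo]

theorem integral_mountainArea (hd : 1 ≤ d) : ∫ t, mountainArea d t = 1 := by
  have hd0 : (0 : ℝ) < d := by exact_mod_cast hd
  have h := integral_mul_mountainArea (fun _ => 1) d
  simp only [one_mul] at h
  rw [h, integral_one_sub_div_pow _ hd0, cast_pred_add_one hd, div_self hd0.ne']

theorem integral_id_mul_mountainArea (hd : 1 ≤ d) :
    ∫ t, t * mountainArea d t = d / (d + 1) := by
  have hd0 : (0 : ℝ) < d := by exact_mod_cast hd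
  rw [integral_mul_mountainArea (fun t => t) d]
  have h : ∀ t : ℝ, t * (1 - t / d) ^ (d - 1) =
      d * ((1 - t / d) ^ (d - 1) - (1 - t / d) ^ d) := by
    intro t
    obtain ⟨n, rfl⟩ : ∃ n, d = n + 1 := ⟨d - 1, by omega⟩
    rw [Nat.add_sub_cancel, pow_succ]
    field_simp
    ring
  simp only [h]
  rw [intervalIntegral.integral_const_mul, intervalIntegral.integral_sub
      (Continuous.intervalIntegrable (by fun_prop) _ _)
      (Continuous.intervalIntegrable (by fun_prop) _ _),
    integral_one_sub_div_pow _ hd0, integral_one_sub_div_pow _ hd0, cast_pred_add_one hd]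
  field_simp
  ring

theorem isCompact_mountain (hFc : IsCompact F) (hF : Convex ℝ F) (hne : F.Nonempty)
    (z : Space d) : IsCompact (mountain F z) := by
  have : mountain F z = (fun q : EuclideanSpace ℝ (Fin (d - 1)) × ℝ =>
      ((q.2 • z.1 + (1 - q.2) • q.1, q.2 * z.2) : Space d)) '' (F ×ˢ Set.Icc 0 1) := by
    ext p
    rw [mem_mountain_iff hF hne]
    constructor
    · rintro ⟨y, hy, s, h0, h1, hp1, hp2⟩
      exact ⟨(y, s), ⟨hy, h0, h1⟩, Prod.ext hp1.symm hp2.symm⟩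
    · rintro ⟨⟨y, s⟩, ⟨hy, h0, h1⟩, rfl⟩
      exact ⟨y, hy, s, h0, h1, rfl, rfl⟩
  rw [this]
  exact (hFc.prod isCompact_Icc).image (by fun_prop)

theorem mountain_ae_eq_openCone (hF : Convex ℝ F) (hne : F.Nonempty) {z : Space d}
    (hz : 0 < z.2) : mountain F z =ᵐ[volume] openCone F z := by
  refine Filter.EventuallyLE.antisymm ?_ (openCone_subset_mountain hF z).eventuallyLE
  have hheight : ∀ c : ℝ, ∀ᵐ p : Space d, p.2 ≠ c := fun c => by
    rw [ae_iff]
    simpa using volume_setOf_height_eq c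
  filter_upwards [hheight 0, hheight z.2] with p h0 h1 hp
  refine mem_openCone_of_mem_mountain hF hne hp (lt_of_le_of_ne ?_ h0.symm) hz h1
  obtain ⟨y, -, s, hs, -, -, hp2⟩ := (mem_mountain_iff hF hne).1 hp
  rw [hp2]
  positivity

theorem volume_mountain (hd : 1 ≤ d) (hFc : IsCompact F) (hF : Convex ℝ F) (hF1 : volume F = 1)
    (hne : F.Nonempty) {z : Space d} (hz : 0 ≤ z.2) :
    volume (mountain F z) = ENNReal.ofReal (z.2 / d) := by
  rcases hz.eq_or_lt with hz | hz
  · -- A mountain of height zero lies in a hyperplane.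
    rw [← hz, zero_div, ENNReal.ofReal_zero]
    refine measure_mono_null (fun p hp => ?_) (volume_setOf_height_eq 0)
    obtain ⟨y, -, s, -, -, -, hp2⟩ := (mem_mountain_iff hF hne).1 hp
    simpa [← hz] using hp2
  · rw [measure_congr (mountain_ae_eq_openCone hF hne hz), volume_openCone hd hFc.measurableSet,
      hF1, mul_one]

theorem nonempty_of_volume_eq_one (hF1 : volume F = 1) : F.Nonempty := by
  rw [Set.nonempty_iff_ne_empty]
  rintro rfl
  simp at hF1

theorem Q_of_isUnitMountain (hd : 1 ≤ d) (hFc : IsCompact F) (hF : Convex ℝ F)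
    (hF1 : volume F = 1) (hM : IsUnitMountain F M) : Q F M = 1 - 2 / ((d : ℝ) + 1) := by
  obtain ⟨⟨z, hz, rfl⟩, hM1⟩ := hM
  have hd0 : (0 : ℝ) < d := by exact_mod_cast hd
  have hne := nonempty_of_volume_eq_one hF1
  have hzd : z.2 = d := by
    rw [volume_mountain hd hFc hF hF1 hne hz, ENNReal.ofReal_eq_one, div_eq_one_iff_eq hd0.ne']
      at hM1
    exact hM1
  have hz0 : 0 < z.2 := hzd ▸ hd0
  have hc := isCompact_mountain hFc hF hne z
  have hm := measurableSet_openCone hFc.measurableSet z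
  have hmean : ∫ p in mountain F z, p.2 = d / (d + 1) := by
    rw [setIntegral_congr_set (mountain_ae_eq_openCone hF hne hz0),
      setIntegral_height hm (f := fun t => t)]
    · simp only [area_openCone hF1 hzd, integral_id_mul_mountainArea hd]
    · exact (ContinuousOn.integrableOn_compact hc (by fun_prop)).mono_set
        (openCone_subset_mountain hF z)
  rw [Q_eq_one_sub_mean_height hd hFc hF hF1 hc (convex_convexHull ℝ _)
    (Set.subset_union_right.trans (subset_convexHull ℝ _)) ?_ hM1, hmean]
  · field_simp
  · intro p hp
    obtain ⟨y, -, s, hs, -, -, hp2⟩ := (mem_mountain_iff hF hne).1 hp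
    rw [hp2]
    positivity

theorem exists_unitMountain (hd : 1 ≤ d) (hFc : IsCompact F) (hF : Convex ℝ F)
    (hF1 : volume F = 1) : ∃ M ∈ SubPrism F, IsUnitMountain F M := by
  have hd0 : (0 : ℝ) < d := by exact_mod_cast hd
  have hne := nonempty_of_volume_eq_one hF1
  have ⟨x, hx⟩ := hne
  have hmem := fun p => mem_mountain_iff hF hne (z := (x, (d : ℝ))) (p := p)
  have hvol : volume (mountain F ((x, (d : ℝ)) : Space d)) = 1 := by
    rw [volume_mountain hd hFc hF hF1 hne hd0.le]
    simp [hd0.ne']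
  refine ⟨mountain F (x, d), ⟨⟨isCompact_mountain hFc hF hne _, convex_convexHull ℝ _, ?_, ?_⟩,
    ⟨d, hd0.le, ?_⟩, hvol⟩, ⟨_, hd0.le, rfl⟩, hvol⟩
  · intro p hp
    obtain ⟨y, -, s, hs, -, -, hp2⟩ := (hmem p).1 hp
    rw [hp2]
    positivity
  · ext p
    constructor
    · rintro ⟨hp, hp0⟩
      obtain ⟨y, hy, s, hs, -, hp1, hp2⟩ := (hmem p).1 hp
      have hs0 : s = 0 := by
        have : s * d = 0 := hp2.symm.trans hp0
        simpa [hd0.ne'] using this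
      refine ⟨?_, hp0⟩
      rw [hp1, hs0]
      simpa using hy
    · intro hp
      exact ⟨subset_convexHull ℝ _ (Or.inr hp), hp.2⟩
  · intro p hp
    obtain ⟨y, hy, s, hs, hs1, hp1, hp2⟩ := (hmem p).1 hp
    refine ⟨hp1 ▸ hF hx hy hs (by linarith) (by ring), ?_, ?_⟩
    · rw [hp2]; positivity
    · rw [hp2]
      exact mul_le_of_le_one_left hd0.le hs1

/-! ### Volume, sections and mean height of the prism -/

theorem unitPrism_mem_subPrism (hFc : IsCompact F) (hF : Convex ℝ F)
    (hF1 : volume F = 1) : unitPrism F ∈ SubPrism F := by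
  refine ⟨⟨hFc.prod isCompact_Icc, hF.prod (convex_Icc 0 1), fun p hp => hp.2.1, ?_⟩,
    ⟨1, zero_le_one, subset_rfl⟩, ?_⟩
  · ext p
    constructor
    · rintro ⟨hp, hp0⟩
      exact ⟨hp.1, hp0⟩
    · rintro ⟨hp, hp0⟩
      have hp0 : p.2 = 0 := hp0
      exact ⟨⟨hp, by simp [hp0]⟩, hp0⟩
  · rw [unitPrism, Measure.volume_eq_prod, Measure.prod_prod, hF1]
    simp

theorem area_unitPrism (hF1 : volume F = 1) (t : ℝ) :
    area (unitPrism F) t = (Set.Icc (0 : ℝ) 1).indicator (fun _ => 1) t := by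
  by_cases ht : t ∈ Set.Icc (0 : ℝ) 1
  · have : {x | (x, t) ∈ unitPrism F} = F := by
      ext x
      exact ⟨fun h => h.1, fun h => ⟨h, ht⟩⟩
    rw [Set.indicator_of_mem ht, area, this, Measure.real, hF1, ENNReal.toReal_one]
  · rw [Set.indicator_of_notMem ht]
    exact area_eq_zero fun x hx => ht hx.2

theorem integral_height_unitPrism (hFc : IsCompact F) (hF1 : volume F = 1) :
    ∫ p in unitPrism F, p.2 = 1 / 2 := by
  have hc : IsCompact (unitPrism F) := hFc.prod isCompact_Icc
  rw [setIntegral_height hc.measurableSet (f := fun t => t)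
    (ContinuousOn.integrableOn_compact hc (by fun_prop))]
  have : (fun t => t * area (unitPrism F) t) = (Set.Icc (0 : ℝ) 1).indicator fun t => t := by
    ext t
    rw [area_unitPrism hF1]
    simp only [Set.indicator_apply]
    split_ifs <;> simp
  rw [this, integral_indicator measurableSet_Icc, integral_Icc_eq_integral_Ioc,
    ← intervalIntegral.integral_of_le zero_le_one, integral_id]
  norm_num

/-! ### Bounds on the mean height of sub-prisms -/

theorem HasFloor.base_subset (hK : HasFloor K F) : base F ⊆ K :=
  hK.inter_eq ▸ Set.inter_subset_left

theorem Q_of_mem_subPrism (hd : 1 ≤ d) (hFc : IsCompact F) (hF : Convex ℝ F)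
    (hF1 : volume F = 1) (hK : K ∈ SubPrism F) : Q F K = 1 - 2 / d * ∫ p in K, p.2 :=
  Q_eq_one_sub_mean_height hd hFc hF hF1 hK.1.isCompact hK.1.convex hK.1.base_subset
    hK.1.height_nonneg hK.2.2

theorem integral_area (hK : K ∈ SubPrism F) : Integrable (area K) ∧ ∫ t, area K t = 1 := by
  have hm := hK.1.isCompact.measurableSet
  have hi : IntegrableOn (fun p : Space d => (fun _ : ℝ => (1 : ℝ)) p.2) K :=
    ContinuousOn.integrableOn_compact hK.1.isCompact (by fun_prop)
  have h1 := integrable_mul_area (f := fun _ => 1) hm hi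
  have h2 := setIntegral_height (f := fun _ => 1) hm hi
  simp only [one_mul] at h1 h2
  refine ⟨h1, ?_⟩
  rw [← h2]
  simp [Measure.real, hK.2.2]

theorem integral_height_eq (hK : K ∈ SubPrism F) :
    Integrable (fun t => t * area K t) ∧ ∫ p in K, p.2 = ∫ t, t * area K t := by
  have hm := hK.1.isCompact.measurableSet
  have hi : IntegrableOn (fun p : Space d => (fun t : ℝ => t) p.2) K :=
    ContinuousOn.integrableOn_compact hK.1.isCompact (by fun_prop)
  exact ⟨integrable_mul_area (f := fun t => t) hm hi, setIntegral_height (f := fun t => t) hm hi⟩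

theorem section_subset (hK : K ∈ SubPrism F) (t : ℝ) : {x | (x, t) ∈ K} ⊆ F := by
  obtain ⟨H, -, hH⟩ := hK.2.1
  exact fun x hx => (hH hx).1

theorem area_le_one (hF1 : volume F = 1) (hK : K ∈ SubPrism F) (t : ℝ) : area K t ≤ 1 := by
  have := ENNReal.toReal_mono (by simp [hF1]) (measure_mono (μ := volume) (section_subset hK t))
  rwa [hF1, ENNReal.toReal_one] at this

theorem area_of_neg (hK : K ∈ SubPrism F) {t : ℝ} (ht : t < 0) : area K t = 0 :=
  area_eq_zero fun _ hx => absurd (hK.1.height_nonneg _ hx) (not_le.2 ht)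

theorem one_half_le_integral_height (hFc : IsCompact F) (hF : Convex ℝ F) (hF1 : volume F = 1)
    (hK : K ∈ SubPrism F) : 1 / 2 ≤ ∫ p in K, p.2 := by
  have hP := unitPrism_mem_subPrism hFc hF hF1
  rw [← integral_height_unitPrism hFc hF1, (integral_height_eq hP).2, (integral_height_eq hK).2]
  refine integral_mul_le_of_single_crossing 1 (integral_area hP).1 (integral_area hK).1
    (integral_height_eq hP).1 (integral_height_eq hK).1
    ((integral_area hP).2.trans (integral_area hK).2.symm) (fun t ht => ?_) (fun t ht => ?_)
  · rcases lt_or_ge t 0 with h0 | h0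
    · rw [area_of_neg hK h0, area_of_neg hP h0]
    · rw [area_unitPrism hF1, Set.indicator_of_mem (Set.mem_Icc.2 ⟨h0, ht.le⟩)]
      exact area_le_one hF1 hK t
  · rw [area_unitPrism hF1, Set.indicator_of_notMem fun h => not_le.2 ht h.2]
    exact area_nonneg K t

/-- Brunn's theorem: the root of the area at an intermediate height `s` is at least the affine
interpolation between its value `1` at the floor and its value at height `t`. -/
theorem pow_le_area (hd : 2 ≤ d) (hFc : IsCompact F) (hF1 : volume F = 1) (hK : K ∈ SubPrism F)
    {s t : ℝ} (hs : 0 < s) (hst : s < t) (ht : 0 < area K t) :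
    (1 - s / t + s / t * area K t ^ (((d - 1 : ℕ) : ℝ)⁻¹)) ^ (d - 1) ≤ area K s := by
  have ht0 := hs.trans hst
  have hlt := (div_lt_one ht0).2 hst
  have hm := hK.1.isCompact.measurableSet
  have hfin : ∀ r, volume {x | (x, r) ∈ K} ≠ ∞ := fun r =>
    ne_top_of_le_ne_top (by simp [hF1]) (measure_mono (section_subset hK r))
  have hroot : (area K t ^ (((d - 1 : ℕ) : ℝ)⁻¹)) ^ (d - 1) = area K t :=
    Real.rpow_inv_natCast_pow ht.le (by omega)
  have h := brunn_minkowski (p := 1 - s / t) (q := s / t)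
    (a := area K t ^ (((d - 1 : ℕ) : ℝ)⁻¹)) (by linarith) (by positivity) (by positivity)
    hFc.measurableSet (measurableSet_section hm t) (measurableSet_section hm s) hF1
    (by rw [hroot, area, Measure.real, ENNReal.ofReal_toReal (hfin t)])
    (by
      intro x hx y hy
      have h0 : ((x, 0) : Space d) ∈ K := hK.1.base_subset ⟨hx, rfl⟩
      have := hK.1.convex h0 hy (a := 1 - s / t) (b := s / t) (by linarith) (by positivity)
        (by ring)
      simpa [div_mul_cancel₀ _ ht0.ne'] using this)
  exact (ENNReal.ofReal_le_iff_le_toReal (hfin s)).1 h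

theorem integral_height_le (hd : 2 ≤ d) (hFc : IsCompact F) (hF1 : volume F = 1)
    (hK : K ∈ SubPrism F) : ∫ p in K, p.2 ≤ d / (d + 1) := by
  have hd0 : (0 : ℝ) < d := by positivity
  rw [(integral_height_eq hK).2, ← integral_id_mul_mountainArea (by omega : 1 ≤ d)]
  have hint := integrable_mul_mountainArea (f := fun _ => 1) continuous_const d
  simp only [one_mul] at hint
  -- The root of the area is concave for `K` and affine for the mountain, and both are `1` at
  -- height `0`: they cross at the largest positive height where `K` has at least the area of the
  -- mountain.
  set S : Set ℝ := {t | 0 < t ∧ 0 < area K t ∧ mountainArea d t ≤ area K t} with hS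
  have hbdd : BddAbove S := by
    obtain ⟨H, -, hH⟩ := hK.2.1
    refine ⟨H, fun t ht => ?_⟩
    by_contra! hlt
    exact ht.2.1.ne' (area_eq_zero fun x hx => absurd (hH hx).2.2 (not_le.2 hlt))
  have hc : 0 ≤ sSup S := Real.sSup_nonneg fun t ht => ht.1.le
  refine integral_mul_le_of_single_crossing (sSup S) (integral_area hK).1 hint
    (integral_height_eq hK).1 (integrable_mul_mountainArea continuous_id d)
    ((integral_area hK).2.trans (integral_mountainArea (by omega)).symm) (fun s hs => ?_)
    (fun t ht => ?_)
  · by_cases hsd : s ∈ Set.Ioo 0 (d : ℝ)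
    swap
    · rw [mountainArea, Set.indicator_of_notMem hsd]
      exact area_nonneg K s
    have hne : S.Nonempty := by
      rw [Set.nonempty_iff_ne_empty]
      intro h
      rw [h, Real.sSup_empty] at hs
      exact lt_asymm hs hsd.1
    obtain ⟨t, ⟨ht0, hpos, htS⟩, hst⟩ := exists_lt_of_lt_csSup hne hs
    refine le_trans ?_ (pow_le_area hd hFc hF1 hK hsd.1 hst hpos)
    rw [mountainArea, Set.indicator_of_mem hsd]
    have hsd1 := (div_le_one hd0).2 hsd.2.le
    refine pow_le_pow_left₀ (by linarith) ?_ _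
    set r := area K t ^ (((d - 1 : ℕ) : ℝ)⁻¹) with hr
    have hr0 : 0 ≤ r := by positivity
    have hroot : r ^ (d - 1) = area K t := Real.rpow_inv_natCast_pow hpos.le (by omega)
    have hrt : 1 - t / d ≤ r := by
      rcases lt_or_ge t d with htd | htd
      · rw [mountainArea, Set.indicator_of_mem (Set.mem_Ioo.2 ⟨ht0, htd⟩), ← hroot] at htS
        exact le_of_pow_le_pow_left₀ (by omega) hr0 htS
      · have := (one_le_div hd0).2 htd
        linarith
    have h1 : s / t * (1 - t / d) ≤ s / t * r :=
      mul_le_mul_of_nonneg_left hrt (div_nonneg hsd.1.le ht0.le)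
    have h2 : s / t * (1 - t / d) = s / t - s / d := by
      field_simp
    linarith
  · by_contra! hlt
    have hmem : t ∈ S := ⟨hc.trans_lt ht, (mountainArea_nonneg d t).trans_lt hlt, hlt.le⟩
    exact not_le.2 ht (le_csSup hbdd hmem)

end FlatFloor

theorem theorem1 (d : ℕ) (hd : 2 ≤ d) (F : Set (EuclideanSpace ℝ (Fin (d - 1))))
    (hFcompact : IsCompact F) (hFconvex : Convex ℝ F) (hFvol : volume F = 1) :
    -- the unit prism and some unit mountain are themselves admissible sets
    FlatFloor.unitPrism F ∈ FlatFloor.SubPrism F ∧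
    (∃ M ∈ FlatFloor.SubPrism F, FlatFloor.IsUnitMountain F M) ∧
    -- the two bounds, for every admissible set and every unit mountain
    (∀ K ∈ FlatFloor.SubPrism F, ∀ M, FlatFloor.IsUnitMountain F M →
      FlatFloor.Q F M ≤ FlatFloor.Q F K ∧
        FlatFloor.Q F K ≤ FlatFloor.Q F (FlatFloor.unitPrism F)) ∧
    -- the two extremal values
    (∀ M, FlatFloor.IsUnitMountain F M → FlatFloor.Q F M = 1 - 2 / ((d : ℝ) + 1)) ∧
    FlatFloor.Q F (FlatFloor.unitPrism F) = 1 - 1 / (d : ℝ) := by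
  have hd1 : 1 ≤ d := by omega
  have hd0 : (0 : ℝ) < d := by positivity
  have hP := FlatFloor.unitPrism_mem_subPrism hFcompact hFconvex hFvol
  have hQP : FlatFloor.Q F (FlatFloor.unitPrism F) = 1 - 1 / (d : ℝ) := by
    rw [FlatFloor.Q_of_mem_subPrism hd1 hFcompact hFconvex hFvol hP,
      FlatFloor.integral_height_unitPrism hFcompact hFvol]
    ring
  have hQM := fun M => FlatFloor.Q_of_isUnitMountain (M := M) hd1 hFcompact hFconvex hFvol
  refine ⟨hP, FlatFloor.exists_unitMountain hd1 hFcompact hFconvex hFvol, fun K hK M hM => ?_,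
    hQM, hQP⟩
  have h2 : (0 : ℝ) ≤ 2 / d := by positivity
  rw [hQM M hM, hQP, FlatFloor.Q_of_mem_subPrism hd1 hFcompact hFconvex hFvol hK]
  constructor
  · have h := mul_le_mul_of_nonneg_left
      (FlatFloor.integral_height_le hd hFcompact hFvol hK) h2
    have : 2 / (d : ℝ) * (d / (d + 1)) = 2 / (d + 1) := by field_simp
    linarith
  · have h := mul_le_mul_of_nonneg_left
      (FlatFloor.one_half_le_integral_height hFcompact hFconvex hFvol hK) h2
    have : 2 / (d : ℝ) * (1 / 2) = 1 / d := by ring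
    linarith
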